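/- Let $\Gamma$ be a torsion-free (word-)hyperbolic group, let $n\ge 1$, and let $z,a_1,\ldots,a_n\in\Gamma$ satisfy $[a_i,z]\ne 1$ for every $i$. Then there is an integer $N\ge 0$, depending only on $\Gamma$, $z$ and $a_1,\ldots,a_n$, such that for all integers $m_1,\ldots,m_n$ with $|m_i|\ge N$ for every $i<n$ (and $m_n$ arbitrary), the element \[ w=a_1z^{m_1}a_2z^{m_2}\cdots a_nz^{m_n} \] does not commute with $z$. -/

import Mathlib

open scoped commutatorElement

/-- A walk in a graph is geodesic if its length is the graph distance between its endpoints. -/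
def IsGeodesicWalk {V : Type*} {G : SimpleGraph V} {x y : V} (p : G.Walk x y) : Prop :=
  p.length = G.dist x y

/-- Geodesic triangles of the graph `G` are `δ`-slim: every vertex on a side is at distance at
most `δ` from some vertex on one of the other two sides. -/
def SlimTriangles {V : Type*} (G : SimpleGraph V) (δ : ℕ) : Prop :=
  ∀ (x y z : V) (p : G.Walk x y) (q : G.Walk y z) (r : G.Walk x z),
    IsGeodesicWalk p → IsGeodesicWalk q → IsGeodesicWalk r →
      ∀ v ∈ p.support, ∃ w : V, (w ∈ q.support ∨ w ∈ r.support) ∧ G.dist v w ≤ δ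

/-- A (word-)hyperbolic group: a group that has a finite generating set `S` such that the geodesic
triangles of its Cayley graph with respect to `S` are uniformly slim. Here `mulCayley` joins `g` to
`g * s` for `s ∈ S`, so the graph distance is the word metric of `S`. -/
def IsHyperbolicGroup (Γ : Type*) [Group Γ] : Prop :=
  ∃ S : Set Γ, S.Finite ∧ Subgroup.closure S = ⊤ ∧
    ∃ δ : ℕ, SlimTriangles (SimpleGraph.mulCayley S) δ

/-- A group is torsion-free if its only element of finite order is the identity. (For
noncommutative groups the class `IsMulTorsionFree` asks for unique roots, which is stronger.) -/
def IsTorsionFreeGroup (Γ : Type*) [Group Γ] : Prop :=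
  ∀ g : Γ, IsOfFinOrder g → g = 1

/-! Write `|g|` for `d 1 g`. The invariant behind the proof is that the Gromov product at `1` of `z
^ l` and `w * z ^ k` is bounded uniformly in `l` and `k` (`exists_add_le_prod`). If `w` commuted
with `z`, then `w * z ^ M = z ^ M * w` would stay within `|w|` of `z ^ M`, so the product would grow
with `M`.

For one syllable (`exists_add_le_of_not_commute`), long fellow-travelling of `⟨z⟩` and `a⟨z⟩`
yields, by quasiconvexity of `⟨z⟩` and pigeonhole, a relation `a * z ^ p * a⁻¹ = z ^ q` with `p, q ≠
0`. In a torsion-free hyperbolic group this forces `a` to commute with `z` (`commute_of_conj_zpow`),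
because `⟨z⟩` has finite index in its centralizer. Further syllables are added by the four-point
inequality: a long power of `z` between them prevents backtracking. -/

/-- An integer-valued left-invariant proper geodesic metric on a group satisfying the four-point
hyperbolicity condition with constant `K`. -/
structure IsHyperbolicWordMetric {Γ : Type*} [Group Γ] (d : Γ → Γ → ℕ) (K : ℕ) : Prop where
  self : ∀ x, d x x = 0
  comm : ∀ x y, d x y = d y x
  tri : ∀ x y z, d x z ≤ d x y + d y z
  inv : ∀ g x y, d (g * x) (g * y) = d x y
  finite_ball : ∀ r, {g | d 1 g ≤ r}.Finite
  geod : ∀ x y k, k ≤ d x y → ∃ p, d x p = k ∧ k + d p y = d x y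
  four : ∀ x y z w, d x y + d z w ≤ max (d x z + d y w) (d x w + d y z) + K

/-! ### Slim triangles and the four-point condition -/

section Graph

variable {V : Type*} {G : SimpleGraph V}

theorem dist_add_dist_of_mem_support {x y v : V} {p : G.Walk x y} (hG : G.Connected)
    (hp : IsGeodesicWalk p) (hv : v ∈ p.support) : G.dist x v + G.dist v y = G.dist x y := by
  classical
  apply le_antisymm _ hG.dist_triangle
  rw [← hp, ← congrArg SimpleGraph.Walk.length (p.take_spec hv), SimpleGraph.Walk.length_append]
  exact add_le_add (SimpleGraph.dist_le _) (SimpleGraph.dist_le _)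

theorem exists_dist_eq_of_le_dist (hG : G.Connected) (x y : V) (k : ℕ) (hk : k ≤ G.dist x y) :
    ∃ p, G.dist x p = k ∧ k + G.dist p y = G.dist x y := by
  obtain ⟨w, hw⟩ := hG.exists_walk_length_eq_dist x y
  have h1 : G.dist x (w.getVert k) ≤ k :=
    (SimpleGraph.dist_le (w.take k)).trans (by simp)
  have h2 : G.dist (w.getVert k) y ≤ G.dist x y - k :=
    (SimpleGraph.dist_le (w.drop k)).trans (by simp [hw])
  have h3 := hG.dist_triangle (u := x) (v := w.getVert k) (w := y)
  exact ⟨w.getVert k, by omega, by omega⟩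

theorem SlimTriangles.exists_near_sides {δ : ℕ} (h : SlimTriangles G δ) (hG : G.Connected)
    {x y v : V} {p : G.Walk x y} (hp : IsGeodesicWalk p) (hv : v ∈ p.support) (z : V) :
    G.dist x v + G.dist v z ≤ G.dist x z + 2 * δ ∨ G.dist y v + G.dist v z ≤ G.dist y z + 2 * δ := by
  obtain ⟨q, hq⟩ := hG.exists_walk_length_eq_dist y z
  obtain ⟨r, hr⟩ := hG.exists_walk_length_eq_dist x z
  obtain ⟨w, hw, hvw⟩ := h x y z p q r hp hq hr v hv
  have hwv := G.dist_comm (u := v) (v := w)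
  have hz := hG.dist_triangle (u := v) (v := w) (w := z)
  rcases hw with hw | hw
  · have h1 := dist_add_dist_of_mem_support hG hq hw
    have h2 := hG.dist_triangle (u := y) (v := w) (w := v)
    omega
  · have h1 := dist_add_dist_of_mem_support hG hr hw
    have h2 := hG.dist_triangle (u := x) (v := w) (w := v)
    omega

theorem SlimTriangles.four_point {δ : ℕ} (h : SlimTriangles G δ) (hG : G.Connected)
    (x y z w : V) :
    G.dist x y + G.dist z w ≤
      max (G.dist x z + G.dist y w) (G.dist x w + G.dist y z) + (4 * δ + 2) := by
  classical
  obtain ⟨p, hp⟩ := hG.exists_walk_length_eq_dist x y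
  have hside := fun i => h.exists_near_sides hG hp (p.getVert_mem_support i) z
  have hex : ∃ i, G.dist y (p.getVert i) + G.dist (p.getVert i) z ≤ G.dist y z + 2 * δ :=
    ⟨p.length, by simp⟩
  -- Take the first vertex almost on a geodesic from `y` to `z`. Its predecessor is almost on one
  -- from `x` to `z`, and one edge costs at most 2.
  obtain ⟨i, hi, hix⟩ : ∃ i,
      G.dist y (p.getVert i) + G.dist (p.getVert i) z ≤ G.dist y z + 2 * δ ∧
      G.dist x (p.getVert i) + G.dist (p.getVert i) z ≤ G.dist x z + (2 * δ + 2) := by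
    refine ⟨Nat.find hex, Nat.find_spec hex, ?_⟩
    rcases hj : Nat.find hex with _ | j
    · simp only [SimpleGraph.Walk.getVert_zero, SimpleGraph.dist_self]
      omega
    · have hmin := Nat.find_min hex (m := j) (by omega)
      have hx := (hside j).resolve_right hmin
      have hstep : G.dist (p.getVert j) (p.getVert (j + 1)) ≤ 1 := by
        by_cases hl : j < p.length
        · exact (SimpleGraph.dist_eq_one_iff_adj.2 (p.adj_getVert_succ hl)).le
        · rw [p.getVert_of_length_le (by omega), p.getVert_of_length_le (by omega)]
          simp
      have hc := G.dist_comm (u := p.getVert j) (v := p.getVert (j + 1))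
      have t1 := hG.dist_triangle (u := x) (v := p.getVert j) (w := p.getVert (j + 1))
      have t2 := hG.dist_triangle (u := p.getVert (j + 1)) (v := p.getVert j) (w := z)
      omega
  have hv := dist_add_dist_of_mem_support hG hp (p.getVert_mem_support i)
  have hw := h.exists_near_sides hG hp (p.getVert_mem_support i) w
  have t := hG.dist_triangle (u := z) (v := p.getVert i) (w := w)
  have c1 := G.dist_comm (u := p.getVert i) (v := z)
  have c2 := G.dist_comm (u := p.getVert i) (v := y)
  rcases hw with hw | hw
  · exact le_trans (by omega) (Nat.add_le_add_right (le_max_right _ _) _)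
  · exact le_trans (by omega) (Nat.add_le_add_right (le_max_left _ _) _)

end Graph

/-! ### The word metric -/

section Cayley

variable {Γ : Type*} [Group Γ] {S : Set Γ}

theorem mulCayley_reachable_mul_left (g : Γ) {x y : Γ}
    (h : (SimpleGraph.mulCayley S).Reachable x y) :
    (SimpleGraph.mulCayley S).Reachable (g * x) (g * y) :=
  h.map ⟨(g * ·), SimpleGraph.mulCayley_adj_mul_iff_right.2⟩

theorem mulCayley_connected (hS : Subgroup.closure S = ⊤) :
    (SimpleGraph.mulCayley S).Connected := by
  have h1 : ∀ g : Γ, (SimpleGraph.mulCayley S).Reachable 1 g := by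
    intro g
    have hg : g ∈ Subgroup.closure S := hS ▸ Subgroup.mem_top g
    induction hg using Subgroup.closure_induction with
    | mem x hx =>
      by_cases h : 1 = x
      · subst h; exact .refl _
      · exact SimpleGraph.Adj.reachable ((SimpleGraph.mulCayley_adj _ _ _).2 ⟨h, by simp [hx]⟩)
    | one => exact .refl _
    | mul x y _ _ hx hy =>
      have hxy := mulCayley_reachable_mul_left x hy
      rw [mul_one] at hxy
      exact hx.trans hxy
    | inv x _ hx => simpa using (mulCayley_reachable_mul_left x⁻¹ hx).symm
  exact ⟨fun x y => (h1 x).symm.trans (h1 y)⟩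

theorem mulCayley_dist_mul_left (hS : Subgroup.closure S = ⊤) (g x y : Γ) :
    (SimpleGraph.mulCayley S).dist (g * x) (g * y) = (SimpleGraph.mulCayley S).dist x y := by
  have key : ∀ g x y : Γ,
      (SimpleGraph.mulCayley S).dist (g * x) (g * y) ≤ (SimpleGraph.mulCayley S).dist x y := by
    intro g x y
    obtain ⟨w, hw⟩ := (mulCayley_connected hS).exists_walk_length_eq_dist x y
    let f : SimpleGraph.mulCayley S →g SimpleGraph.mulCayley S :=
      ⟨(g * ·), SimpleGraph.mulCayley_adj_mul_iff_right.2⟩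
    have := SimpleGraph.dist_le (w.map f)
    rwa [SimpleGraph.Walk.length_map, hw] at this
  exact (key g x y).antisymm (by simpa using key g⁻¹ (g * x) (g * y))

theorem mulCayley_finite_ball (hfin : S.Finite) (hS : Subgroup.closure S = ⊤) (r : ℕ) :
    {g : Γ | (SimpleGraph.mulCayley S).dist 1 g ≤ r}.Finite := by
  have hconn := mulCayley_connected hS
  induction r with
  | zero =>
    refine (Set.finite_singleton (1 : Γ)).subset fun g hg => ?_
    exact (hconn.dist_eq_zero_iff.1 (Nat.le_zero.1 hg)).symm
  | succ r ih =>
    refine (ih.union (ih.mul (hfin.union hfin.inv))).subset fun g hg => ?_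
    by_cases hle : (SimpleGraph.mulCayley S).dist 1 g ≤ r
    · exact Or.inl hle
    · have hg' : (SimpleGraph.mulCayley S).dist 1 g ≤ r + 1 := hg
      obtain ⟨p, hp1, hp2⟩ := exists_dist_eq_of_le_dist hconn 1 g r (by omega)
      have hadj : (SimpleGraph.mulCayley S).Adj p g :=
        SimpleGraph.dist_eq_one_iff_adj.1 (by omega)
      refine Or.inr ⟨p, hp1.le, p⁻¹ * g, ?_, by simp⟩
      rcases ((SimpleGraph.mulCayley_adj _ _ _).1 hadj).2 with h | h
      · exact Or.inl h
      · exact Or.inr (by simpa using h)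

end Cayley

theorem IsHyperbolicGroup.exists_metric {Γ : Type*} [Group Γ] (hΓ : IsHyperbolicGroup Γ) :
    ∃ (d : Γ → Γ → ℕ) (K : ℕ), IsHyperbolicWordMetric d K := by
  obtain ⟨S, hfin, hS, δ, hδ⟩ := hΓ
  have hconn := mulCayley_connected hS
  exact ⟨(SimpleGraph.mulCayley S).dist, 4 * δ + 2,
    { self := fun _ => SimpleGraph.dist_self
      comm := fun _ _ => SimpleGraph.dist_comm
      tri := fun _ _ _ => hconn.dist_triangle
      inv := mulCayley_dist_mul_left hS
      finite_ball := mulCayley_finite_ball hfin hS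
      geod := exists_dist_eq_of_le_dist hconn
      four := hδ.four_point hconn }⟩

/-! ### Powers in torsion-free groups -/

section Order

variable {Γ : Type*} [Group Γ]

theorem IsTorsionFreeGroup.zpow_injective (htf : IsTorsionFreeGroup Γ) {u : Γ} (hu : u ≠ 1) :
    Function.Injective fun n : ℤ => u ^ n :=
  injective_zpow_iff_not_isOfFinOrder.2 fun h => hu (htf u h)

theorem IsTorsionFreeGroup.eq_one_of_pow (htf : IsTorsionFreeGroup Γ) {u : Γ} {n : ℕ} (hn : 0 < n)
    (h : u ^ n = 1) : u = 1 :=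
  htf u (isOfFinOrder_iff_pow_eq_one.2 ⟨n, hn, h⟩)

end Order

/-! ### Growth and finite index in centralizers -/

namespace IsHyperbolicWordMetric

variable {Γ : Type*} [Group Γ] {d : Γ → Γ → ℕ} {K : ℕ}

theorem dist_one_inv_mul (H : IsHyperbolicWordMetric d K) (x y : Γ) : d 1 (x⁻¹ * y) = d x y := by
  simpa using (H.inv x 1 (x⁻¹ * y)).symm

theorem dist_self_mul (H : IsHyperbolicWordMetric d K) (x y : Γ) : d x (x * y) = d 1 y := by
  simpa using H.inv x 1 y

theorem exists_forall_lt_dist_zpow (H : IsHyperbolicWordMetric d K) {u : Γ}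
    (hu : Function.Injective fun n : ℤ => u ^ n) (r : ℕ) :
    ∃ N : ℕ, ∀ m : ℤ, (N : ℤ) ≤ |m| → r < d 1 (u ^ m) := by
  have hfin : {m : ℤ | d 1 (u ^ m) ≤ r}.Finite := (H.finite_ball r).preimage hu.injOn
  obtain ⟨b, hb⟩ := (hfin.image fun m : ℤ => m.natAbs).bddAbove
  refine ⟨b + 1, fun m hm => ?_⟩
  by_contra! hle
  have : m.natAbs ≤ b := hb (Set.mem_image_of_mem _ hle)
  rw [Int.abs_eq_natAbs] at hm
  omega

/-- A point of a geodesic that is far from the endpoints is almost on every geodesic whose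
endpoints are close to those of the first. -/
theorem almost_between (H : IsHyperbolicWordMetric d K) {x y x' y' q : Γ} {r e : ℕ}
    (hx : d x x' ≤ r) (hy : d y y' ≤ r) (hq : d x' q + d q y' ≤ d x' y' + e)
    (hxq : r + K + e < d x' q) (hqy : r + 2 * K + e < d q y') :
    d x q + d q y ≤ d x y + (2 * K + e) := by
  have h1 := H.four x q x' y'
  have h2 := H.four q y x y'
  have c1 := H.comm q x'
  have c2 := H.comm y x
  have c3 := H.comm q x
  omega

theorem dist_le_of_almost_between (H : IsHyperbolicWordMetric d K) {x y q q' : Γ} {e r : ℕ}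
    (hq : d x q + d q y ≤ d x y + e) (hq' : d x q' + d q' y ≤ d x y + e)
    (h : d x q ≤ d x q' + r) (h' : d x q' ≤ d x q + r) : d q q' ≤ e + r + K := by
  have h1 := H.four q q' x y
  have c1 := H.comm q x
  have c2 := H.comm q' x
  omega

/-- Centralizers of elements of infinite order have at most linear growth. -/
theorem card_centralizer_le (H : IsHyperbolicWordMetric d K) {u : Γ}
    (hu : Function.Injective fun n : ℤ => u ^ n) :
    ∃ B : ℕ, ∀ (r : ℕ) (T : Finset Γ), (∀ g ∈ T, Commute u g ∧ d 1 g ≤ r) →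
      T.card ≤ B * (2 * r + 1) := by
  classical
  refine ⟨(H.finite_ball (3 * K)).toFinset.card, fun r T hT => ?_⟩
  obtain ⟨N, hN⟩ := H.exists_forall_lt_dist_zpow hu (2 * (r + 2 * K + 1))
  obtain ⟨p, hp1, hp2⟩ := H.geod 1 (u ^ N) (r + 2 * K + 1)
    (by have := hN N (by simp); rw [zpow_natCast] at this; omega)
  have hlong : 2 * (r + 2 * K + 1) < d 1 (u ^ N) := by simpa using hN N (by simp)
  -- Since `g` commutes with `u ^ N`, it moves both ends of the geodesic by at most `r`, so `g * p`
  -- is almost between `1` and `u ^ N`. These points occupy at most `2 * r + 1` distances from `1`,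
  -- and those at equal distance are within `3 * K` of each other.
  have hbet : ∀ g ∈ T, d 1 (g * p) + d (g * p) (u ^ N) ≤ d 1 (u ^ N) + 2 * K := by
    intro g hg
    obtain ⟨hc, hr⟩ := hT g hg
    have e1 : d g (g * p) = d 1 p := H.dist_self_mul _ _
    have e2 : d (g * p) (g * u ^ N) = d p (u ^ N) := H.inv _ _ _
    have e3 : d g (g * u ^ N) = d 1 (u ^ N) := H.dist_self_mul _ _
    refine H.almost_between (e := 0) (x' := g) (y' := g * u ^ N) hr ?_ ?_ ?_ ?_
    · rw [← (hc.pow_left N).eq, H.dist_self_mul]; exact hr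
    all_goals omega
  have himage : T.image (fun g => d 1 (g * p)) ⊆
      Finset.Icc (r + 2 * K + 1 - r) (r + 2 * K + 1 + r) := by
    intro s hs
    obtain ⟨g, hg, rfl⟩ := Finset.mem_image.1 hs
    have hr := (hT g hg).2
    have e1 : d g (g * p) = d 1 p := H.dist_self_mul _ _
    have t1 := H.tri 1 g (g * p)
    have t2 := H.tri g 1 (g * p)
    have c := H.comm g 1
    rw [Finset.mem_Icc]
    omega
  calc T.card ≤ (H.finite_ball (3 * K)).toFinset.card * (T.image fun g => d 1 (g * p)).card := by
        refine Finset.card_le_mul_card_image _ _ fun s hs => ?_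
        obtain ⟨g₀, hg₀, rfl⟩ := Finset.mem_image.1 hs
        refine Finset.card_le_card_of_injOn (fun g => (g₀ * p)⁻¹ * (g * p)) ?_ ?_
        · intro g hg
          obtain ⟨hgT, hgs⟩ := Finset.mem_filter.1 hg
          simp only [Set.Finite.coe_toFinset, Set.mem_ofPred_eq]
          rw [H.dist_one_inv_mul]
          have := H.dist_le_of_almost_between (r := 0) (hbet g₀ hg₀) (hbet g hgT)
            (by omega) (by omega)
          omega
        · intro g _ g' _ h
          simpa using h
    _ ≤ (H.finite_ball (3 * K)).toFinset.card * (2 * r + 1) := by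
        refine Nat.mul_le_mul_left _ ((Finset.card_le_card himage).trans ?_)
        rw [Nat.card_Icc]
        omega

theorem dist_one_pow_le (H : IsHyperbolicWordMetric d K) (u : Γ) (n : ℕ) :
    d 1 (u ^ n) ≤ n * d 1 u := by
  induction n with
  | zero => simp [H.self]
  | succ n ih =>
    have h1 := H.tri 1 (u ^ n) (u ^ n * u)
    rw [H.dist_self_mul] at h1
    rw [pow_succ]
    linarith

/-- Multiplying representatives of many cosets by powers of `u` produces more elements of the
centralizer than linear growth allows. The number of cosets beats the slope `2 * B * d 1 u`, and `J`
beats the constant term. -/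
theorem finite_quotient_centralizer (H : IsHyperbolicWordMetric d K) {u : Γ}
    (hu : Function.Injective fun n : ℤ => u ^ n) :
    Finite (Subgroup.centralizer {u} ⧸
      (Subgroup.zpowers u).subgroupOf (Subgroup.centralizer {u})) := by
  classical
  obtain ⟨B, hB⟩ := H.card_centralizer_le hu
  by_contra hinf
  rw [not_finite_iff_infinite] at hinf
  obtain ⟨R, hR⟩ := Infinite.exists_subset_card_eq (Subgroup.centralizer {u} ⧸
      (Subgroup.zpowers u).subgroupOf (Subgroup.centralizer {u})) (2 * B * d 1 u + 1)
  let rep : (Subgroup.centralizer {u} ⧸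
      (Subgroup.zpowers u).subgroupOf (Subgroup.centralizer {u})) → Γ := fun c => (c.out : Γ)
  let L := R.sup fun c => d 1 (rep c)
  let J := B * (2 * L + 1) + 1
  let T : Finset Γ := (R ×ˢ Finset.range J).image fun x => rep x.1 * u ^ x.2
  have hT : ∀ g ∈ T, Commute u g ∧ d 1 g ≤ L + J * d 1 u := by
    intro g hg
    obtain ⟨⟨c, j⟩, hcj, rfl⟩ := Finset.mem_image.1 hg
    obtain ⟨hc, hj⟩ := Finset.mem_product.1 hcj
    constructor
    · have : Commute u (rep c) := Subgroup.mem_centralizer_singleton_iff.1 c.out.2 |>.symm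
      exact this.mul_right (Commute.self_pow u j)
    · have h1 := H.tri 1 (rep c) (rep c * u ^ j)
      rw [H.dist_self_mul] at h1
      have h2 : d 1 (rep c) ≤ L := Finset.le_sup (f := fun c => d 1 (rep c)) hc
      have h3 : j * d 1 u ≤ J * d 1 u := Nat.mul_le_mul_right _ (Finset.mem_range.1 hj).le
      have h4 := H.dist_one_pow_le u j
      exact h1.trans (by omega)
  have hinj : Set.InjOn (fun x : _ × ℕ => rep x.1 * u ^ x.2) (R ×ˢ Finset.range J : Finset _) := by
    rintro ⟨c, j⟩ _ ⟨c', j'⟩ _ h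
    simp only at h
    have hcc : c = c' := by
      rw [← QuotientGroup.out_eq' c, ← QuotientGroup.out_eq' c', QuotientGroup.eq,
        Subgroup.mem_subgroupOf]
      refine ⟨(j : ℤ) - j', ?_⟩
      simp only [zpow_sub, zpow_natCast, Subgroup.coe_mul, Subgroup.coe_inv]
      rw [eq_inv_mul_iff_mul_eq, ← mul_assoc, mul_inv_eq_iff_eq_mul]
      exact h
    subst hcc
    have hj : (fun n : ℤ => u ^ n) j = (fun n : ℤ => u ^ n) j' := by simpa using h
    simpa using hu hj
  have hcard : T.card = (2 * B * d 1 u + 1) * J := by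
    rw [Finset.card_image_of_injOn hinj, Finset.card_product, hR, Finset.card_range]
  have hle := hB _ T hT
  rw [hcard] at hle
  have hJ : J = B * (2 * L + 1) + 1 := rfl
  have : B * (2 * (L + J * d 1 u) + 1) = B * (2 * L + 1) + 2 * B * d 1 u * J := by ring
  rw [this, add_mul, one_mul] at hle
  omega

end IsHyperbolicWordMetric

/-! ### Indices of cyclic subgroups and the transfer -/

section Order

variable {Γ : Type*} [Group Γ]

theorem relIndex_zpowers_zpow {u : Γ} (hu : Function.Injective fun n : ℤ => u ^ n) (p : ℤ) :
    (Subgroup.zpowers (u ^ p)).relIndex (Subgroup.zpowers u) = p.natAbs := by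
  have hf : Function.Injective (zpowersHom Γ u) := fun m n h =>
    Multiplicative.toAdd.injective (hu (by simpa using h))
  have h1 : (Subgroup.zpowers (u ^ p)) =
      (Subgroup.zpowers (Multiplicative.ofAdd p)).map (zpowersHom Γ u) := by
    simp [MonoidHom.map_zpowers]
  have h2 : Subgroup.zpowers u = (⊤ : Subgroup (Multiplicative ℤ)).map (zpowersHom Γ u) := by
    ext x
    simp [Subgroup.mem_zpowers_iff]
  rw [h1, h2, Subgroup.relIndex_map_map_of_injective _ _ hf, Subgroup.relIndex_top_right]
  exact Int.index_zmultiples p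

/-- A torsion-free group whose centre has finite index is commutative. -/
theorem IsTorsionFreeGroup.commute_of_finiteIndex_center (htf : IsTorsionFreeGroup Γ)
    [(Subgroup.center Γ).FiniteIndex] (x y : Γ) : Commute x y := by
  -- The transfer to the centre is the power map by the index; its target is abelian, so it kills
  -- commutators.
  have h : MonoidHom.transferCenterPow Γ ⁅x, y⁆ = 1 := by
    rw [map_commutatorElement, commutatorElement_eq_one_iff_mul_comm]
    exact Subtype.ext ((Subgroup.mem_center_iff.1 (MonoidHom.transferCenterPow Γ y).2 _))
  have h' := congrArg Subtype.val h
  rw [MonoidHom.transferCenterPow_apply] at h'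
  exact commutatorElement_eq_one_iff_commute.1
    (htf.eq_one_of_pow (Nat.pos_of_ne_zero Subgroup.FiniteIndex.index_ne_zero) h')

theorem IsTorsionFreeGroup.subgroup (htf : IsTorsionFreeGroup Γ) (A : Subgroup Γ) :
    IsTorsionFreeGroup A := fun g hg =>
  Subtype.ext (htf g (A.subtype.isOfFinOrder hg))

end Order

/-! ### Commutation and conjugate powers -/

namespace IsHyperbolicWordMetric

variable {Γ : Type*} [Group Γ] {d : Γ → Γ → ℕ} {K : ℕ}

theorem relIndex_centralizer_ne_zero (H : IsHyperbolicWordMetric d K)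
    (htf : IsTorsionFreeGroup Γ) {u : Γ} (hu : u ≠ 1) :
    (Subgroup.zpowers u).relIndex (Subgroup.centralizer {u}) ≠ 0 := by
  have := H.finite_quotient_centralizer (htf.zpow_injective hu)
  exact Subgroup.index_ne_zero_of_finite

/-- Commuting is transitive on nontrivial elements of a torsion-free hyperbolic group. -/
theorem commute_trans (H : IsHyperbolicWordMetric d K) (htf : IsTorsionFreeGroup Γ) {u x y : Γ}
    (hu : u ≠ 1) (hx : Commute x u) (hy : Commute y u) : Commute x y := by
  have hle : (Subgroup.zpowers u).subgroupOf (Subgroup.centralizer {u}) ≤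
      Subgroup.center (Subgroup.centralizer {u}) := by
    rintro ⟨g, hg⟩ hgu
    obtain ⟨k, rfl⟩ := Subgroup.mem_subgroupOf.1 hgu
    refine Subgroup.mem_center_iff.2 fun b => Subtype.ext ?_
    have hb : Commute (b : Γ) u := Subgroup.mem_centralizer_singleton_iff.1 b.2
    exact (hb.zpow_right k).eq
  have : ((Subgroup.zpowers u).subgroupOf (Subgroup.centralizer {u})).FiniteIndex :=
    ⟨H.relIndex_centralizer_ne_zero htf hu⟩
  have := Subgroup.finiteIndex_of_le hle
  have h := (htf.subgroup (Subgroup.centralizer {u})).commute_of_finiteIndex_center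
    ⟨x, Subgroup.mem_centralizer_singleton_iff.2 hx⟩
    ⟨y, Subgroup.mem_centralizer_singleton_iff.2 hy⟩
  exact congrArg Subtype.val h.eq

theorem centralizer_zpow (H : IsHyperbolicWordMetric d K) (htf : IsTorsionFreeGroup Γ) {z : Γ}
    (hz : z ≠ 1) {p : ℤ} (hp : p ≠ 0) :
    Subgroup.centralizer {z ^ p} = Subgroup.centralizer {z} := by
  have hzp : z ^ p ≠ 1 := fun h => hp (htf.zpow_injective hz (by simpa using h))
  ext g
  rw [Subgroup.mem_centralizer_singleton_iff, Subgroup.mem_centralizer_singleton_iff]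
  exact ⟨fun h => H.commute_trans htf hzp h (Commute.self_zpow z p),
    fun h => (Commute.zpow_right h p)⟩

/-- Conjugation preserves the index of a cyclic group in the centralizer of its generator, and `z ^
p`, `z ^ q` share the centralizer of `z`; hence `|p| = |q|`. If `q = -p`, then `a ^ 2` centralizes
`z ^ p`, so some positive power of `a` lies in `⟨z ^ p⟩`. It is both fixed and inverted by `a`, so
`a` is torsion. -/
theorem commute_of_conj_zpow (H : IsHyperbolicWordMetric d K) (htf : IsTorsionFreeGroup Γ)
    {a z : Γ} (hz : z ≠ 1) {p q : ℤ} (hp : p ≠ 0) (hq : q ≠ 0)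
    (h : a * z ^ p * a⁻¹ = z ^ q) : Commute a z := by
  have hinj := htf.zpow_injective hz
  have hindex : ∀ s : ℤ, s ≠ 0 →
      (Subgroup.zpowers (z ^ s)).relIndex (Subgroup.centralizer {z ^ s}) =
        s.natAbs * (Subgroup.zpowers z).relIndex (Subgroup.centralizer {z}) := by
    intro s hs
    rw [H.centralizer_zpow htf hz hs, ← relIndex_zpowers_zpow hinj s,
      Subgroup.relIndex_mul_relIndex]
    · exact Subgroup.zpowers_le.2 (Subgroup.zpow_mem_zpowers z s)
    · exact Subgroup.zpowers_le.2 (Subgroup.mem_centralizer_singleton_iff.2 rfl)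
  have hconj : (Subgroup.zpowers (z ^ p)).relIndex (Subgroup.centralizer {z ^ p}) =
      (Subgroup.zpowers (z ^ q)).relIndex (Subgroup.centralizer {z ^ q}) := by
    let f := (MulAut.conj a).toMonoidHom
    have hf : Function.Injective f := (MulAut.conj a).injective
    have hfz : f (z ^ p) = z ^ q := h
    have h1 : (Subgroup.zpowers (z ^ p)).map f = Subgroup.zpowers (z ^ q) := by
      rw [MonoidHom.map_zpowers, hfz]
    have h2 : (Subgroup.centralizer {z ^ p}).map f = Subgroup.centralizer {z ^ q} := by
      ext g
      simp only [Subgroup.mem_map, Subgroup.mem_centralizer_singleton_iff]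
      constructor
      · rintro ⟨x, hx, rfl⟩
        rw [← hfz, ← map_mul, hx, map_mul]
      · intro hg
        obtain ⟨x, rfl⟩ : ∃ x, f x = g := (MulAut.conj a).surjective g
        refine ⟨x, hf ?_, rfl⟩
        rw [map_mul, map_mul, hfz, hg]
    rw [← Subgroup.relIndex_map_map_of_injective _ _ hf, h1, h2]
  rw [hindex p hp, hindex q hq] at hconj
  have hpq := Nat.eq_of_mul_eq_mul_right
    (Nat.pos_of_ne_zero (H.relIndex_centralizer_ne_zero htf hz)) hconj
  have hzp : z ^ p ≠ 1 := fun h => hp (hinj (by simpa using h))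
  rcases Int.natAbs_eq_natAbs_iff.1 hpq with rfl | hneg
  · exact H.commute_trans htf hzp (mul_inv_eq_iff_eq_mul.1 h) (Commute.self_zpow z p)
  · have hinv : a * z ^ p * a⁻¹ = (z ^ p)⁻¹ := by rw [h, hneg, zpow_neg, inv_inv]
    have hsq : Commute (a ^ 2) (z ^ p) := by
      have : a * (a * z ^ p * a⁻¹) * a⁻¹ = z ^ p := by
        rw [hinv, ← conj_inv, hinv, inv_inv]
      refine mul_inv_eq_iff_eq_mul.1 (Eq.trans ?_ this)
      simp only [sq, mul_inv_rev, mul_assoc]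
    have hind := H.relIndex_centralizer_ne_zero htf hzp
    obtain ⟨k, hk, -, hmem⟩ := Subgroup.exists_pow_mem_of_relIndex_ne_zero hind
      (Subgroup.mem_centralizer_singleton_iff.2 hsq)
    obtain ⟨s, hs⟩ := Subgroup.mem_zpowers_iff.1 hmem.1
    have hself : (z ^ p) ^ s = ((z ^ p) ^ s)⁻¹ := by
      calc (z ^ p) ^ s = a * (z ^ p) ^ s * a⁻¹ := by
            rw [hs, ← pow_mul, ← pow_succ', pow_succ, mul_inv_cancel_right]
        _ = (a * z ^ p * a⁻¹) ^ s := conj_zpow.symm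
        _ = ((z ^ p) ^ s)⁻¹ := by rw [hinv, inv_zpow]
    have ha : a = 1 := by
      refine htf.eq_one_of_pow (n := 2 * k * 2) (by omega) ?_
      rw [pow_mul, pow_mul, ← hs, sq]
      nth_rewrite 1 [hself]
      exact inv_mul_cancel _
    rw [ha]
    exact Commute.one_left z

end IsHyperbolicWordMetric

/-! ### Quasiconvexity and divergence of cosets -/

namespace IsHyperbolicWordMetric

variable {Γ : Type*} [Group Γ] {d : Γ → Γ → ℕ} {K : ℕ}

theorem dist_mul_le_of_almost_between (H : IsHyperbolicWordMetric d K) {z c x : Γ} {e : ℕ}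
    (hc : Commute z c) (hx : d 1 x + d x c ≤ d 1 c + e) :
    d x (z * x) ≤ 3 * d 1 z + 4 * K + 2 * e := by
  have e1 : d z (z * x) = d 1 x := H.dist_self_mul _ _
  have e2 : d (z * x) (z * c) = d x c := H.inv _ _ _
  have e3 : d z (z * c) = d 1 c := H.dist_self_mul _ _
  have e4 : d c (z * c) = d 1 z := by rw [hc.eq, H.dist_self_mul]
  have c1 := H.comm x 1
  have c2 := H.comm z 1
  have c3 := H.comm (z * x) (z * c)
  have t1 := H.tri x 1 (z * x)
  have t2 := H.tri 1 z (z * x)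
  have t3 := H.tri x c (z * x)
  have t4 := H.tri c (z * c) (z * x)
  by_cases hshort : d 1 x ≤ d 1 z + K + e
  · omega
  by_cases hshort' : d x c ≤ d 1 z + 2 * K + e
  · omega
  have h := H.almost_between (x := 1) (y := c) (x' := z) (y' := z * c) (q := z * x) (r := d 1 z)
    (e := e) le_rfl e4.le (by omega) (by omega) (by omega)
  have t5 := H.tri z 1 (z * x)
  have := H.dist_le_of_almost_between (r := d 1 z) (e := 2 * K + e) (hx.trans (by omega)) h
    (by omega) (by omega)
  omega

/-- Cyclic subgroups of a torsion-free hyperbolic group are quasiconvex. -/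
theorem exists_zpow_near (H : IsHyperbolicWordMetric d K) {z : Γ}
    (hz : Function.Injective fun n : ℤ => z ^ n) (e : ℕ) :
    ∃ R : ℕ, ∀ (m : ℤ) (x : Γ), d 1 x + d x (z ^ m) ≤ d 1 (z ^ m) + e →
      ∃ j : ℤ, d (z ^ j) x ≤ R := by
  -- Fix one conjugator for each conjugate of `z`. Only finitely many conjugates `x⁻¹ * z * x`
  -- arise, so `x` is boundedly close to the centralizer of `z`, hence to `⟨z⟩`.
  have hex : ∀ y, ∃ t : Γ, (∃ s, s⁻¹ * z * s = y) → t⁻¹ * z * t = y := by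
    intro y
    by_cases h : ∃ s, s⁻¹ * z * s = y
    · exact ⟨h.choose, fun _ => h.choose_spec⟩
    · exact ⟨1, fun h' => absurd h' h⟩
  choose t ht using hex
  obtain ⟨R₁, hR₁⟩ := ((H.finite_ball (3 * d 1 z + 4 * K + 2 * e)).image
    fun y => d 1 (t y)).bddAbove
  have := H.finite_quotient_centralizer hz
  obtain ⟨R₂, hR₂⟩ := (Set.finite_range fun c : Subgroup.centralizer {z} ⧸
      (Subgroup.zpowers z).subgroupOf (Subgroup.centralizer {z}) =>
        d 1 (c.out : Γ)).bddAbove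
  refine ⟨R₂ + R₁, fun m x hx => ?_⟩
  have hdisp := H.dist_mul_le_of_almost_between (Commute.self_zpow z m) hx
  rw [← H.dist_one_inv_mul, ← mul_assoc] at hdisp
  have hty := ht (x⁻¹ * z * x) ⟨x, rfl⟩
  set s := t (x⁻¹ * z * x)
  have hs1 : d 1 s ≤ R₁ := hR₁ (Set.mem_image_of_mem (fun y => d 1 (t y)) hdisp)
  have hgz : x * s⁻¹ ∈ Subgroup.centralizer {z} := by
    rw [Subgroup.mem_centralizer_singleton_iff]
    calc x * s⁻¹ * z = x * (s⁻¹ * z * s) * s⁻¹ := by group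
      _ = z * (x * s⁻¹) := by rw [hty]; group
  let g : Subgroup.centralizer {z} := ⟨x * s⁻¹, hgz⟩
  let b := (QuotientGroup.mk g : Subgroup.centralizer {z} ⧸
      (Subgroup.zpowers z).subgroupOf (Subgroup.centralizer {z})).out
  have hb : d 1 (b : Γ) ≤ R₂ := hR₂ (Set.mem_range_self _)
  have hbg : b⁻¹ * g ∈ (Subgroup.zpowers z).subgroupOf (Subgroup.centralizer {z}) :=
    QuotientGroup.eq.1 (QuotientGroup.out_eq' _)
  obtain ⟨j, hj⟩ := Subgroup.mem_subgroupOf.1 hbg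
  have hbz : Commute (b : Γ) z := Subgroup.mem_centralizer_singleton_iff.1 b.2
  have hgb : z ^ j * b = x * s⁻¹ := by
    rw [← (hbz.zpow_right j).eq]
    simp only at hj
    rw [hj]
    simp [g]
  refine ⟨j, (H.tri _ (z ^ j * b) _).trans (add_le_add ?_ ?_)⟩
  · rwa [H.dist_self_mul]
  · rw [hgb, ← H.dist_one_inv_mul]
    simpa using hs1

/-- Geodesics from `1` fellow-travel up to the Gromov product of their endpoints, which is at least
`C / 2` here. -/
theorem dist_le_of_geod_of_add_le (H : IsHyperbolicWordMetric d K) {u v x y : Γ} {k C : ℕ}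
    (huv : d u v + C ≤ d 1 u + d 1 v) (hk : 2 * k ≤ C) (hx : d 1 x = k)
    (hxu : k + d x u = d 1 u) (hy : d 1 y = k) (hyv : k + d y v = d 1 v) : d x y ≤ 2 * K := by
  have h := H.four x v 1 u
  have c1 := H.comm x 1
  have c2 := H.comm v u
  have c3 := H.comm v 1
  have := H.dist_le_of_almost_between (x := 1) (y := v) (q := x) (q' := y) (e := K) (r := 0)
    (by omega) (by omega) (by omega) (by omega)
  omega

/-- Long powers of `z` and their translates by an element not commuting with `z` diverge. -/
theorem exists_add_le_of_not_commute (H : IsHyperbolicWordMetric d K) (htf : IsTorsionFreeGroup Γ)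
    {a z : Γ} (h : ¬ Commute a z) :
    ∃ C : ℕ, ∀ m m' : ℤ, d 1 (z ^ m) + d 1 (a * z ^ m') ≤ d (z ^ m) (a * z ^ m') + C := by
  have hz1 : z ≠ 1 := by rintro rfl; exact h (Commute.one_right a)
  have hz := htf.zpow_injective hz1
  obtain ⟨R, hR⟩ := H.exists_zpow_near hz (2 * d 1 a)
  let F := (H.finite_ball (2 * R + 2 * K)).toFinset
  -- Leaves room for `F.card + 1` depths spaced by `2 * R + 1`, so that errors of `R` cannot make
  -- two depths share the same power of `z`.
  let C := 2 * ((2 * R + 1) * (F.card + 1))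
  refine ⟨C, fun m m' => ?_⟩
  by_contra! hlt
  have key : ∀ i, i < F.card + 1 → ∃ α β : ℤ, (z ^ α)⁻¹ * (a * z ^ β) ∈ F ∧
      d 1 (z ^ α) ≤ (2 * R + 1) * i + R ∧ (2 * R + 1) * i ≤ d 1 (z ^ α) + R := by
    intro i hi
    have hik : (2 * R + 1) * i ≤ (2 * R + 1) * (F.card + 1) := Nat.mul_le_mul_left _ hi.le
    have hC : C = 2 * ((2 * R + 1) * (F.card + 1)) := rfl
    generalize (2 * R + 1) * i = k at hik ⊢
    have t1 := H.tri (z ^ m) 1 (a * z ^ m')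
    have t2 := H.tri 1 (z ^ m) (a * z ^ m')
    have t3 := H.tri 1 (a * z ^ m') (z ^ m)
    have c1 := H.comm (z ^ m) (a * z ^ m')
    obtain ⟨x, hx1, hx2⟩ := H.geod 1 (z ^ m) k (by omega)
    obtain ⟨y, hy1, hy2⟩ := H.geod 1 (a * z ^ m') k (by omega)
    have hxy := H.dist_le_of_geod_of_add_le (C := C) (by omega) (by omega) hx1 hx2 hy1 hy2
    obtain ⟨α, hα⟩ := hR m x (by omega)
    obtain ⟨β, hβ⟩ := hR m' (a⁻¹ * y) (by
      have e1 : d (a⁻¹ * y) (z ^ m') = d y (a * z ^ m') := by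
        simpa using H.inv a⁻¹ y (a * z ^ m')
      have e2 : d 1 (a⁻¹ * y) = d a y := H.dist_one_inv_mul _ _
      have e3 : d a (a * z ^ m') = d 1 (z ^ m') := H.dist_self_mul _ _
      have t4 := H.tri a 1 y
      have t5 := H.tri 1 a (a * z ^ m')
      have c2 := H.comm a 1
      omega)
    have e4 : d (a * z ^ β) y = d (z ^ β) (a⁻¹ * y) := by
      simpa using H.inv a (z ^ β) (a⁻¹ * y)
    have c3 := H.comm (a * z ^ β) y
    have c4 := H.comm (z ^ α) x
    have t6 := H.tri (z ^ α) x (a * z ^ β)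
    have t7 := H.tri x y (a * z ^ β)
    have t8 := H.tri 1 x (z ^ α)
    have t9 := H.tri 1 (z ^ α) x
    refine ⟨α, β, ?_, by omega, by omega⟩
    simp only [F, Set.Finite.mem_toFinset, Set.mem_ofPred_eq]
    rw [H.dist_one_inv_mul]
    omega
  -- Two depths with the same difference in `F` give the conjugacy relation between powers of `z`.
  choose! α β hF hα hα' using key
  obtain ⟨i, hi, j, hj, hij, heq⟩ := Finset.exists_ne_map_eq_of_card_lt_of_maps_to
    (s := Finset.range (F.card + 1)) (t := F) (by simp)
    (f := fun i => (z ^ α i)⁻¹ * (a * z ^ β i)) (fun i hi => hF i (Finset.mem_range.1 hi))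
  have hne : α i ≠ α j := by
    intro hαij
    have h1 := hα i (Finset.mem_range.1 hi)
    have h2 := hα' i (Finset.mem_range.1 hi)
    have h3 := hα j (Finset.mem_range.1 hj)
    have h4 := hα' j (Finset.mem_range.1 hj)
    rw [hαij] at h1 h2
    rcases Nat.lt_or_gt_of_ne hij with hlt' | hlt'
    · have := Nat.mul_le_mul_left (2 * R + 1) (Nat.succ_le_of_lt hlt')
      rw [Nat.succ_eq_add_one, mul_add, mul_one] at this
      omega
    · have := Nat.mul_le_mul_left (2 * R + 1) (Nat.succ_le_of_lt hlt')
      rw [Nat.succ_eq_add_one, mul_add, mul_one] at this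
      omega
  have hconj : a * z ^ (β i - β j) * a⁻¹ = z ^ (α i - α j) := by
    have heq' : z ^ α j * ((z ^ α i)⁻¹ * (a * z ^ β i)) = a * z ^ β j := by
      rw [show (z ^ α i)⁻¹ * (a * z ^ β i) = (z ^ α j)⁻¹ * (a * z ^ β j) from heq,
        mul_inv_cancel_left]
    have h5 : a * z ^ β i = z ^ (α i - α j) * (a * z ^ β j) := by
      rw [← heq', zpow_sub]
      group
    rw [zpow_sub, ← mul_assoc, h5]
    group
  have hq : α i - α j ≠ 0 := sub_ne_zero.2 hne
  have hp : β i - β j ≠ 0 := by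
    intro h0
    rw [h0, zpow_zero, mul_one, mul_inv_cancel] at hconj
    exact hq (hz (by simpa using hconj.symm))
  exact h (H.commute_of_conj_zpow htf hz1 hp hq hconj)

theorem exists_add_le_prod (H : IsHyperbolicWordMetric d K) (htf : IsTorsionFreeGroup Γ) {z : Γ}
    (n : ℕ) (a : Fin (n + 1) → Γ) (ha : ∀ i, ¬ Commute (a i) z) :
    ∃ N C : ℕ, ∀ m : Fin (n + 1) → ℤ,
      (∀ i : Fin (n + 1), (i : ℕ) + 1 < n + 1 → (N : ℤ) ≤ |m i|) → ∀ l k : ℤ,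
        d 1 (z ^ l) + d 1 ((List.ofFn fun i => a i * z ^ m i).prod * z ^ k) ≤
          d (z ^ l) ((List.ofFn fun i => a i * z ^ m i).prod * z ^ k) + C := by
  induction n with
  | zero =>
    obtain ⟨C, hC⟩ := H.exists_add_le_of_not_commute htf (ha 0)
    -- The free exponent `k` absorbs the last `m i`, which therefore needs no lower bound.
    refine ⟨0, C, fun m _ l k => ?_⟩
    simpa [mul_assoc, zpow_add] using hC l (m 0 + k)
  | succ n ih =>
    have hz1 : z ≠ 1 := by rintro rfl; exact ha 0 (Commute.one_right _)
    obtain ⟨C₁, hC₁⟩ := H.exists_add_le_of_not_commute htf (ha 0)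
    obtain ⟨N', C', hC'⟩ := ih (fun i => a i.succ) (fun i => ha i.succ)
    -- This threshold rules out the first alternative of the maximum in `hfour`; the second gives
    -- the bound `C₁ + K`.
    obtain ⟨N, hN⟩ := H.exists_forall_lt_dist_zpow (htf.zpow_injective hz1)
      (C₁ + K + C' + 2 * d 1 (a 0))
    refine ⟨max N N', C₁ + K, fun m hm l k => ?_⟩
    have hlong := hN (m 0) (le_trans (by simp) (hm 0 (by simp)))
    have hrest := hC' (fun i => m i.succ)
      (fun i hi => le_trans (by simp) (hm i.succ (by simpa using hi))) (-m 0) k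
    rw [List.ofFn_succ, List.prod_cons]
    set W := (List.ofFn fun i : Fin (n + 1) => a i.succ * z ^ m i.succ).prod * z ^ k with hW
    rw [mul_assoc, ← hW, mul_assoc]
    have e1 : d (z ^ (-m 0)) W = d 1 (z ^ m 0 * W) := by
      rw [← H.dist_one_inv_mul, zpow_neg, inv_inv]
    have e2 : d 1 (z ^ (-m 0)) = d 1 (z ^ m 0) := by
      rw [zpow_neg, H.comm 1 (z ^ m 0)]
      simpa using H.dist_one_inv_mul (z ^ m 0) 1
    have e3 : d (a 0) (a 0 * z ^ m 0) = d 1 (z ^ m 0) := H.dist_self_mul _ _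
    have e4 : d (a 0) (a 0 * (z ^ m 0 * W)) = d 1 (z ^ m 0 * W) := H.dist_self_mul _ _
    have e5 : d (a 0 * z ^ m 0) (a 0 * (z ^ m 0 * W)) = d 1 W := by
      rw [← mul_assoc, H.dist_self_mul]
    have t1 := H.tri (a 0) 1 (a 0 * z ^ m 0)
    have t2 := H.tri (a 0) 1 (a 0 * (z ^ m 0 * W))
    have c1 := H.comm (a 0) 1
    have c2 := H.comm (a 0 * z ^ m 0) 1
    have c3 := H.comm (z ^ l) 1
    have hdiv := hC₁ l (m 0)
    have hfour := H.four (z ^ l) (a 0 * z ^ m 0) 1 (a 0 * (z ^ m 0 * W))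
    omega

end IsHyperbolicWordMetric

theorem lemmal {Γ : Type*} [Group Γ] (hΓ : IsHyperbolicGroup Γ) (htf : IsTorsionFreeGroup Γ)
    (n : ℕ) (hn : 1 ≤ n) (z : Γ) (a : Fin n → Γ) (ha : ∀ i, ⁅a i, z⁆ ≠ 1) :
    ∃ N : ℕ, ∀ m : Fin n → ℤ, (∀ i : Fin n, (i : ℕ) + 1 < n → (N : ℤ) ≤ |m i|) →
      ¬ Commute (List.ofFn fun i => a i * z ^ m i).prod z := by
  obtain ⟨d, K, H⟩ := hΓ.exists_metric
  obtain ⟨n, rfl⟩ := Nat.exists_eq_add_of_le' hn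
  have ha' : ∀ i, ¬ Commute (a i) z := fun i h =>
    ha i (commutatorElement_eq_one_iff_commute.2 h)
  have hz : z ≠ 1 := by rintro rfl; exact ha' 0 (Commute.one_right _)
  obtain ⟨N, C, hC⟩ := H.exists_add_le_prod htf n a ha'
  refine ⟨N, fun m hm hcomm => ?_⟩
  have hbound := hC m hm
  set w := (List.ofFn fun i => a i * z ^ m i).prod
  obtain ⟨M, hM⟩ := H.exists_forall_lt_dist_zpow (htf.zpow_injective hz) (d 1 w + C)
  have h1 := hM M (le_abs_self _)
  have h2 := hbound M M
  rw [(hcomm.zpow_right M).eq, H.dist_self_mul] at h2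
  omega
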